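/- Let $H$ be a finite-dimensional Hopf algebra over a field $\Bbbk$, with antipode $S$ and coproduct $h\mapsto h_{(1)}\otimes h_{(2)}$, and let $\mathcal C=H\text{-mod}$ be the rigid monoidal category of finite-dimensional left $H$-modules, where $h\cdot(v\otimes w)=h_{(1)}v\otimes h_{(2)}w$ and the left dual $V^*$ carries the action $(h\cdot f)(v)=f(S(h)v)$. Let $G(H)$ and $G(H^*)$ be the groups of grouplike elements of $H$ and of $H^*$ (so $G(H^*)$ consists of the algebra maps $H\to\Bbbk$, with the convolution product). The distinguished grouplike elements $\alpha_H\in G(H^*)$ and $g_H\in G(H)$ are the unique ones such that $$\Lambda h=\alpha_H(h)\Lambda\quad(h\in H),\qquad p\,\lambda=p(g_H)\,\lambda\quad(p\in H^*),$$ where $\Lambda$ is a nonzero left integral of $H$ and $\lambda$ is a nonzero right integral of $H^*$. Let $D$ be the distinguished invertible object of $\mathcal C$, that is, the one-dimensional $H$-module with $h\cdot d=\alpha_H^{-1}(h)d$, and let $\xi_D(X)\colon D\otimes X\to X^{4*}\otimes D$, $\xi_D(X)(d\otimes x)=g_Hx\otimes d$, be the Radford isomorphism (here and below the vector spaces $X$,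 $X^{**}$ and $X^{4*}$ are identified by evaluation). An object of $\mathcal Z(\mathsf{Id}_{\mathcal C},(-)^{**})$ is a pair $(V,\sigma_V)$ of an object $V$ of $\mathcal C$ and a natural isomorphism $\sigma_V(X)\colon V\otimes X\to X^{**}\otimes V$ in $\mathcal C$ that is compatible with tensor products, $\sigma_V(X\otimes Y)=(\mathsf{Id}_{X^{**}}\otimes\sigma_V(Y))(\sigma_V(X)\otimes\mathsf{Id}_Y)$, and with the unit object, $\sigma_V(\mathbb 1)=\mathsf{Id}_V$, up to the canonical isomorphisms. Two objects $(V,\sigma_V)$ and $(V',\sigma_{V'})$ are equivalent if there is an isomorphism $f\colon V\to V'$ in $\mathcal C$ with $\sigma_{V'}(X)(f\otimes\mathsf{Id}_X)=(\mathsf{Id}_{X^{**}}\otimes f)\sigma_V(X)$ for all $X$. Let $\mathsf{Sqrt}_{\mathcal C}(D,\xi_D)$ be the set of equivalence classes of those $(V,\sigma_V)$ with $V$ invertible (the evaluation $V^*\otimes V\to\mathbb 1$ and the coevaluation $\mathbb 1\to V\otimes V^*$ are isomorphisms) for which there is an isomorphism $\nu\colon V^{**}\otimes V\to D$ in $\mathcal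 C$ such that, for all $X$, $$\xi_D(X)\,(\nu\otimes\mathsf{Id}_X)=(\mathsf{Id}_{X^{4*}}\otimes\nu)\,(\sigma_V(X)^{**}\otimes\mathsf{Id}_V)\,(\mathsf{Id}_{V^{**}}\otimes\sigma_V(X)).$$ Then there is a bijection between the set of pairs $(\zeta,a)\in G(H^*)\times G(H)$ such that $$\zeta^2=\alpha_H,\qquad a^2=g_H,\qquad S^2(h)=\zeta^{-1}(h_{(1)})\,a\,h_{(2)}\,a^{-1}\,\zeta(h_{(3)})\quad\text{for all }h\in H,$$ and the set $\mathsf{Sqrt}_{\mathcal C}(D,\xi_D)$. Explicitly, it sends $(\zeta,a)$ to the class of those $(V,\sigma_V)$ for which $h\cdot v=\zeta^{-1}(h)v$ and $\sigma_V(X)(v\otimes x)=ax\otimes v$ for all $h\in H$, $v\in V$, $x\in X$ and all $X$. -/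

import Mathlib

open scoped TensorProduct

universe u

noncomputable section

namespace HopfRep

open Module HopfAlgebra Coalgebra

/-! ### Finite-dimensional modules over a Hopf algebra: tensor products and left duals -/

/-- A finite-dimensional left module over the Hopf algebra `H`, given by its action `ρ`.
These are the objects of the category of finite-dimensional left `H`-modules. -/
structure FDMod (k H : Type u) [Field k] [Ring H] [HopfAlgebra k H] where
  carrier : Type u
  [addCommGroup : AddCommGroup carrier]
  [module : Module k carrier]
  [finite : Module.Finite k carrier]
  ρ : H →ₐ[k] Module.End k carrier

attribute [instance] FDMod.addCommGroup FDMod.module FDMod.finite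

variable {k H : Type u} [Field k] [Ring H] [HopfAlgebra k H]

instance : CoeSort (FDMod k H) (Type u) := ⟨FDMod.carrier⟩

/-- `f` is a morphism of `H`-modules `V ⟶ W`. -/
def IsHom (V W : FDMod k H) (f : V →ₗ[k] W) : Prop :=
  ∀ (h : H) (v : V), f (V.ρ h v) = W.ρ h (f v)

/-- The tensor product, with `h · (v ⊗ w) = h₍₁₎ v ⊗ h₍₂₎ w`. -/
abbrev FDMod.tensor (V W : FDMod k H) : FDMod k H where
  carrier := V ⊗[k] W
  ρ := ((Module.endTensorEndAlgHom (R := k) (S := k) (A := k) (M := V) (N := W)).comp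
    (Algebra.TensorProduct.map V.ρ W.ρ)).comp (Bialgebra.comulAlgHom k H)

/-- The left dual `V*`, with `(h · f)(v) = f (S(h) v)`. -/
abbrev FDMod.dual (V : FDMod k H) : FDMod k H where
  carrier := Dual k V
  ρ := AlgHom.ofLinearMap
    { toFun := fun h => (V.ρ (antipode k h)).dualMap
      map_add' := fun x y => by ext f v; simp
      map_smul' := fun c x => by ext f v; simp }
    (by ext f v; simp)
    (fun x y => by ext f v; simp [antipode_mul_antidistrib])

/-- The one-dimensional module `k` on which `H` acts through the character `χ`. -/
abbrev FDMod.ofChar (χ : H →ₐ[k] k) : FDMod k H where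
  carrier := k
  ρ := (Algebra.lmul k k).comp χ

/-- The unit object: `k` with `H` acting through the counit. -/
abbrev FDMod.unit : FDMod k H := FDMod.ofChar (Bialgebra.counitAlgHom k H)

/-- `V` is invertible: the evaluation `V* ⊗ V → 1` and the coevaluation `1 → V ⊗ V*` are
isomorphisms. -/
def FDMod.Invertible (V : FDMod k H) : Prop :=
  Function.Bijective (contractLeft k V) ∧ Function.Bijective (coevaluation k V)

/-- The monoidal structure `X** ⊗ Y** ≅ (X ⊗ Y)**` of the double dual functor. On underlying
spaces it sends `ev_x ⊗ ev_y` to `ev_{x ⊗ y}`. -/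
def ddTensor (X Y : Type u) [AddCommGroup X] [Module k X] [Module.Finite k X]
    [AddCommGroup Y] [Module k Y] [Module.Finite k Y] :
    Dual k (Dual k X) ⊗[k] Dual k (Dual k Y) ≃ₗ[k] Dual k (Dual k (X ⊗[k] Y)) :=
  (TensorProduct.congr (evalEquiv k X).symm (evalEquiv k Y).symm).trans (evalEquiv k (X ⊗[k] Y))

/-! ### The category `𝒵(Id, (-)**)` -/

/-- An object `(V, σ)` of `𝒵(Id, (-)**)`: an `H`-module `V` with a natural isomorphism of
`H`-modules `σ X : V ⊗ X ≅ X** ⊗ V`, compatible with the monoidal structures. -/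
structure ZObj (k H : Type u) [Field k] [Ring H] [HopfAlgebra k H] where
  V : FDMod k H
  σ : ∀ X : FDMod k H, V ⊗[k] X ≃ₗ[k] Dual k (Dual k X) ⊗[k] V
  σ_hom : ∀ X : FDMod k H, IsHom (V.tensor X) (X.dual.dual.tensor V) (σ X).toLinearMap
  σ_natural : ∀ (X Y : FDMod k H) (f : X →ₗ[k] Y), IsHom X Y f →
    (σ Y).toLinearMap ∘ₗ f.lTensor V = f.dualMap.dualMap.rTensor V ∘ₗ (σ X).toLinearMap
  σ_tensor : ∀ X Y : FDMod k H,
    (σ (X.tensor Y)).toLinearMap =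
      (ddTensor X Y).toLinearMap.rTensor V ∘ₗ
      (TensorProduct.assoc k (Dual k (Dual k X)) (Dual k (Dual k Y)) V).symm.toLinearMap ∘ₗ
      (σ Y).toLinearMap.lTensor (Dual k (Dual k X)) ∘ₗ
      (TensorProduct.assoc k (Dual k (Dual k X)) V Y).toLinearMap ∘ₗ
      (σ X).toLinearMap.rTensor Y ∘ₗ
      (TensorProduct.assoc k V X Y).symm.toLinearMap
  σ_unit : ∀ v : V, σ FDMod.unit (v ⊗ₜ[k] (1 : k)) = Dual.eval k k 1 ⊗ₜ[k] v

/-- Equivalence of objects of `𝒵(Id, (-)**)`: an isomorphism `f : V ≅ V'` of `H`-modules with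
`σ' X ∘ (f ⊗ id) = (id ⊗ f) ∘ σ X` for all `X`. -/
def ZObj.Equivalent (P Q : ZObj k H) : Prop :=
  ∃ f : P.V ≃ₗ[k] Q.V, IsHom P.V Q.V f.toLinearMap ∧
    ∀ X : FDMod k H,
      (Q.σ X).toLinearMap ∘ₗ f.toLinearMap.rTensor X =
        f.toLinearMap.lTensor (Dual k (Dual k X)) ∘ₗ (P.σ X).toLinearMap

theorem ZObj.equivalent_equivalence : Equivalence (ZObj.Equivalent (k := k) (H := H)) where
  refl P := ⟨LinearEquiv.refl k P.V, fun _ _ => rfl, fun X => by ext; simp⟩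
  symm := by
    rintro P Q ⟨f, hf, h⟩
    refine ⟨f.symm, fun x v => ?_, fun X => ?_⟩
    · apply f.injective
      simpa using (hf x (f.symm v)).symm
    · ext v x
      have := LinearMap.congr_fun (h X) (f.symm v ⊗ₜ x)
      simp only [LinearMap.comp_apply, LinearMap.rTensor_tmul, LinearEquiv.coe_coe,
        LinearEquiv.apply_symm_apply] at this
      simp only [TensorProduct.AlgebraTensorModule.curry_apply, LinearMap.restrictScalars_self,
        TensorProduct.curry_apply, LinearMap.comp_apply, LinearMap.rTensor_tmul,
        LinearEquiv.coe_coe, this]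
      rw [← LinearMap.comp_apply, ← LinearMap.lTensor_comp]
      simp
  trans := by
    rintro P Q R ⟨f, hf, h⟩ ⟨f', hf', h'⟩
    refine ⟨f.trans f', fun x v => ?_, fun X => ?_⟩
    · have h1 := hf x v
      have h2 := hf' x (f v)
      simp only [LinearEquiv.coe_coe] at h1 h2
      simp [h1, h2]
    · rw [LinearEquiv.coe_trans, LinearMap.rTensor_comp, LinearMap.lTensor_comp,
        ← LinearMap.comp_assoc, h' X, LinearMap.comp_assoc, h X, LinearMap.comp_assoc]

/-- The morphism `σ(X)** : V** ⊗ X** → X**** ⊗ V**`, the double dual of `σ X` read through the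
monoidal structure of the double dual functor. -/
def ZObj.σdd (P : ZObj k H) (X : FDMod k H) :
    Dual k (Dual k P.V) ⊗[k] Dual k (Dual k X) →ₗ[k]
      Dual k (Dual k (Dual k (Dual k X))) ⊗[k] Dual k (Dual k P.V) :=
  (ddTensor (Dual k (Dual k X)) P.V).symm.toLinearMap ∘ₗ
    (P.σ X).toLinearMap.dualMap.dualMap ∘ₗ (ddTensor P.V X).toLinearMap

/-- `(V, σ)` is a square root of `(D, ξ)`: there is an isomorphism of `H`-modules
`ν : V** ⊗ V ≅ D` such that, for all `X`,
`ξ X ∘ (ν ⊗ id) = (id ⊗ ν) ∘ (σ(X)** ⊗ id) ∘ (id ⊗ σ(X))` as maps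
`V** ⊗ V ⊗ X → X**** ⊗ D`. -/
def ZObj.IsSqrt (P : ZObj k H) (D : FDMod k H)
    (ξ : ∀ X : FDMod k H, D ⊗[k] X →ₗ[k] Dual k (Dual k (Dual k (Dual k X))) ⊗[k] D) : Prop :=
  ∃ ν : Dual k (Dual k P.V) ⊗[k] P.V ≃ₗ[k] D,
    IsHom (P.V.dual.dual.tensor P.V) D ν.toLinearMap ∧
    ∀ X : FDMod k H,
      ξ X ∘ₗ ν.toLinearMap.rTensor X =
        ν.toLinearMap.lTensor (Dual k (Dual k (Dual k (Dual k X)))) ∘ₗ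
        (TensorProduct.assoc k (Dual k (Dual k (Dual k (Dual k X))))
          (Dual k (Dual k P.V)) P.V).toLinearMap ∘ₗ
        (P.σdd X).rTensor P.V ∘ₗ
        (TensorProduct.assoc k (Dual k (Dual k P.V)) (Dual k (Dual k X)) P.V).symm.toLinearMap ∘ₗ
        (P.σ X).toLinearMap.lTensor (Dual k (Dual k P.V)) ∘ₗ
        (TensorProduct.assoc k (Dual k (Dual k P.V)) P.V X).toLinearMap

/-- The objects of which `Sqrt(D, ξ)` consists: the invertible `(V, σ)` in `𝒵(Id, (-)**)` that
are square roots of `(D, ξ)`. -/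
def SqrtObj (D : FDMod k H)
    (ξ : ∀ X : FDMod k H, D ⊗[k] X →ₗ[k] Dual k (Dual k (Dual k (Dual k X))) ⊗[k] D) :
    Type (u + 1) :=
  {P : ZObj k H // P.V.Invertible ∧ P.IsSqrt D ξ}

instance SqrtObj.setoid (D : FDMod k H)
    (ξ : ∀ X : FDMod k H, D ⊗[k] X →ₗ[k] Dual k (Dual k (Dual k (Dual k X))) ⊗[k] D) :
    Setoid (SqrtObj D ξ) where
  r P Q := P.1.Equivalent Q.1
  iseqv := ⟨fun P => ZObj.equivalent_equivalence.refl P.1,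
    fun h => ZObj.equivalent_equivalence.symm h,
    fun h h' => ZObj.equivalent_equivalence.trans h h'⟩

/-- The set `Sqrt(D, ξ)` of equivalence classes. -/
def SqrtSet (D : FDMod k H)
    (ξ : ∀ X : FDMod k H, D ⊗[k] X →ₗ[k] Dual k (Dual k (Dual k (Dual k X))) ⊗[k] D) :
    Type (u + 1) :=
  Quotient (SqrtObj.setoid D ξ)

/-! ### Distinguished grouplikes

The grouplike elements of the dual Hopf algebra `H*` are the algebra maps `H →ₐ[k] k`; the
product of `H*` is the convolution product, Mathlib's product on `WithConv`. The facts proved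
here say that integrals exist and are unique up to scalars, so that `α_H` and `g_H` are
well defined. -/

/-- The antipode is an anti-coalgebra map: `Δ(S a) = S a₍₂₎ ⊗ S a₍₁₎`. -/
theorem comul_antipode (a : H) :
    comul (antipode k a) =
      TensorProduct.map (antipode k) (antipode k) (TensorProduct.comm k H H (comul a)) := by
  let j₁ : H →ₐ[k] H ⊗[k] H := Algebra.TensorProduct.includeLeft
  let j₂ : H →ₐ[k] H ⊗[k] H := Algebra.TensorProduct.includeRight
  let A : WithConv (H →ₗ[k] H ⊗[k] H) := WithConv.toConv j₁.toLinearMap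
  let B : WithConv (H →ₗ[k] H ⊗[k] H) := WithConv.toConv j₂.toLinearMap
  let A' : WithConv (H →ₗ[k] H ⊗[k] H) := WithConv.toConv (j₁.toLinearMap ∘ₗ antipode k)
  let B' : WithConv (H →ₗ[k] H ⊗[k] H) := WithConv.toConv (j₂.toLinearMap ∘ₗ antipode k)
  have hone : ∀ j : H →ₐ[k] H ⊗[k] H,
      WithConv.toConv (j.toLinearMap ∘ₗ antipode k) * WithConv.toConv j.toLinearMap = 1 := by
    intro j
    have := LinearMap.algHom_comp_convMul_distrib j (WithConv.toConv (antipode k (A := H)))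
      (WithConv.toConv (LinearMap.id : H →ₗ[k] H))
    rw [LinearMap.antipode_mul_id] at this
    apply WithConv.ofConv_injective
    refine Eq.trans this.symm ?_
    ext x
    simp
  have hAB : A * B = WithConv.toConv (comul : H →ₗ[k] H ⊗[k] H) := by
    apply WithConv.ofConv_injective
    ext x
    show (LinearMap.mul' k (H ⊗[k] H)) (TensorProduct.map j₁.toLinearMap j₂.toLinearMap (comul x))
      = comul x
    generalize comul (R := k) x = t
    induction t with
    | zero => simp
    | add s t hs ht => rw [map_add, map_add, hs, ht]
    | tmul u v => simp [j₁, j₂]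
  have hBA : B' * A' = WithConv.toConv (TensorProduct.map (antipode k) (antipode k) ∘ₗ
      (TensorProduct.comm k H H).toLinearMap ∘ₗ (comul : H →ₗ[k] H ⊗[k] H)) := by
    apply WithConv.ofConv_injective
    ext x
    show (LinearMap.mul' k (H ⊗[k] H)) (TensorProduct.map (j₂.toLinearMap ∘ₗ antipode k)
      (j₁.toLinearMap ∘ₗ antipode k) (comul x)) =
      TensorProduct.map (antipode k) (antipode k) (TensorProduct.comm k H H (comul x))
    generalize comul (R := k) x = t
    induction t with
    | zero => simp
    | add s t hs ht => simp only [map_add, hs, ht]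
    | tmul u v => simp [j₁, j₂]
  have hl : (B' * A') * (A * B) = 1 := by
    rw [mul_assoc, ← mul_assoc A', hone j₁, one_mul, hone j₂]
  rw [hAB] at hl
  have hr := LinearMap.comul_right_inv (R := k) (C := H)
  have := left_inv_eq_right_inv hl hr
  rw [hBA] at this
  exact (LinearMap.congr_fun (congrArg WithConv.ofConv this) a).symm

/-- The map `y ↦ p(y₍₁₎) y₍₂₎`. -/
def slice (p : H →ₗ[k] k) : H →ₗ[k] H :=
  (TensorProduct.lid k H).toLinearMap ∘ₗ p.rTensor H ∘ₗ comul

theorem comul_slice (p : H →ₗ[k] k) (y : H) :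
    comul (slice p y) = (slice p).rTensor H (comul y) := by
  have h1 : ∀ t : H ⊗[k] H,
      comul (TensorProduct.lid k H (p.rTensor H t)) =
        TensorProduct.lid k (H ⊗[k] H) (p.rTensor (H ⊗[k] H) (comul.lTensor H t)) := by
    intro t
    induction t with
    | zero => simp
    | add s t hs ht => simp only [map_add, hs, ht]
    | tmul u v => simp
  have h2 : ∀ t : H ⊗[k] H, (slice p).rTensor H t =
        TensorProduct.lid k (H ⊗[k] H) (p.rTensor (H ⊗[k] H)
          (TensorProduct.assoc k H H H (comul.rTensor H t))) := by
    intro t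
    induction t with
    | zero => simp
    | add s t hs ht => simp only [map_add, hs, ht]
    | tmul u v =>
      simp only [LinearMap.rTensor_tmul, slice, LinearMap.comp_apply, LinearEquiv.coe_coe]
      generalize comul (R := k) u = s
      induction s with
      | zero => simp
      | add s t hs ht => simp only [map_add, TensorProduct.add_tmul, hs, ht]
      | tmul a b => simp [TensorProduct.smul_tmul']
  rw [h2, Coalgebra.coassoc_apply]
  exact h1 _

theorem counit_slice (p : H →ₗ[k] k) (y : H) : counit (R := k) (slice p y) = p y := by
  have h1 : ∀ t : H ⊗[k] H, counit (R := k) (TensorProduct.lid k H (p.rTensor H t)) =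
      p (TensorProduct.rid k H (counit.lTensor H t)) := by
    intro t
    induction t with
    | zero => simp
    | add s t hs ht => simp only [map_add, hs, ht]
    | tmul u v => simp [mul_comm]
  refine (h1 _).trans ?_
  simp

theorem sum_tmul_slice {ι : Type*} [Fintype ι] (b : Basis ι k H) (y : H) :
    ∑ i, b i ⊗ₜ[k] slice (b.coord i) y = comul y := by
  simp only [slice, LinearMap.comp_apply]
  generalize comul (R := k) y = t
  induction t with
  | zero => simp
  | add s t hs ht => simp only [map_add, TensorProduct.tmul_add, Finset.sum_add_distrib, hs, ht]
  | tmul u v =>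
    conv_rhs => rw [← b.sum_repr u, TensorProduct.sum_tmul]
    simp [TensorProduct.smul_tmul]

/-- `q(S(h) y₍₁₎) y₍₂₎ = h₍₁₎ q(z₍₁₎) z₍₂₎` with `z = S(h₍₂₎) y`. -/
theorem slice_comp_mulLeft (q : H →ₗ[k] k) (h y : H) :
    slice (q ∘ₗ LinearMap.mulLeft k (antipode k h)) y =
      LinearMap.mul' k H ((slice q ∘ₗ LinearMap.mulRight k y ∘ₗ antipode k).lTensor H
        (comul h)) := by
  -- both sides are linear in `Δ(y)`
  have key : ∀ c : H ⊗[k] H,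
      TensorProduct.lid k H ((q ∘ₗ LinearMap.mulLeft k (antipode k h)).rTensor H c) =
        LinearMap.mul' k H ((((TensorProduct.lid k H).toLinearMap ∘ₗ q.rTensor H ∘ₗ
          LinearMap.mulRight k c) ∘ₗ comul ∘ₗ antipode k).lTensor H (comul h)) := by
    intro c
    induction c with
    | zero =>
      have : LinearMap.mulRight k (0 : H ⊗[k] H) = 0 := by ext; simp
      simp [this]
    | add s t hs ht =>
      have : LinearMap.mulRight k (s + t) = LinearMap.mulRight k s + LinearMap.mulRight k t := by
        ext x; simp [mul_add]
      simp only [map_add, this, LinearMap.comp_add, LinearMap.add_comp, LinearMap.lTensor_add,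
        LinearMap.add_apply, hs, ht]
    | tmul u v =>
      let F : H ⊗[k] (H ⊗[k] H) →ₗ[k] H :=
        LinearMap.mulRight k v ∘ₗ (TensorProduct.rid k H).toLinearMap ∘ₗ
        TensorProduct.map (LinearMap.mul' k H ∘ₗ (antipode k).lTensor H)
          (q ∘ₗ LinearMap.mulRight k u ∘ₗ antipode k) ∘ₗ
        (TensorProduct.assoc k H H H).symm.toLinearMap
      have h1 : ∀ t : H ⊗[k] H, LinearMap.mul' k H ((((TensorProduct.lid k H).toLinearMap ∘ₗ
          q.rTensor H ∘ₗ LinearMap.mulRight k (u ⊗ₜ[k] v)) ∘ₗ comul ∘ₗ antipode k).lTensor H t) =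
          F (comul.lTensor H t) := by
        intro t
        induction t with
        | zero => simp
        | add s t hs ht => simp only [map_add, hs, ht]
        | tmul l r =>
          simp only [LinearMap.lTensor_tmul, LinearMap.comp_apply, comul_antipode]
          generalize comul (R := k) r = s
          induction s with
          | zero => simp
          | add s t hs ht => simp only [map_add, TensorProduct.tmul_add, hs, ht]
          | tmul a b => simp [F, mul_assoc]
      rw [h1, ← Coalgebra.coassoc_apply]
      have h2 : ∀ t : H ⊗[k] H, F (TensorProduct.assoc k H H H (comul.rTensor H t)) =
          LinearMap.mulRight k v (TensorProduct.lid k H (TensorProduct.comm k H k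
            (TensorProduct.map (Algebra.linearMap k H)
            (q ∘ₗ LinearMap.mulRight k u ∘ₗ antipode k) (counit.rTensor H t)))) := by
        intro t
        induction t with
        | zero => simp
        | add s t hs ht => simp only [map_add, hs, ht]
        | tmul l r =>
          have := mul_antipode_lTensor_comul_apply (R := k) l
          simp [F, this]
      rw [h2]
      simp [Algebra.smul_def]
  have h3 := key (comul y)
  refine h3.trans ?_
  congr 3
  ext x
  simp [slice]

theorem conv_eq_slice (l p : H →ₗ[k] k) (y : H) :
    (WithConv.toConv l * WithConv.toConv p) y = p (slice l y) := by
  have : ∀ t : H ⊗[k] H, LinearMap.mul' k k (TensorProduct.map l p t) =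
      p (TensorProduct.lid k H (l.rTensor H t)) := by
    intro t
    induction t with
    | zero => simp
    | add s t hs ht => simp only [map_add, hs, ht]
    | tmul u v => simp
  exact this _

/-- `l` is a right integral in `H*`: `l p = p(1) l` for all `p ∈ H*`. -/
def IsRightIntegralDual (l : H →ₗ[k] k) : Prop :=
  ∀ p : H →ₗ[k] k, WithConv.toConv l * WithConv.toConv p = p 1 • WithConv.toConv l

theorem isRightIntegralDual_iff (l : H →ₗ[k] k) :
    IsRightIntegralDual l ↔ ∀ y : H, slice l y = l y • (1 : H) := by
  constructor
  · intro h y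
    rw [← sub_eq_zero, ← Module.forall_dual_apply_eq_zero_iff k]
    intro p
    have := congrArg (fun f : WithConv (H →ₗ[k] k) => f y) (h p)
    simp only [conv_eq_slice] at this
    rw [map_sub, this, map_smul, sub_eq_zero]
    exact mul_comm _ _
  · intro h p
    apply WithConv.ofConv_injective
    ext y
    refine (conv_eq_slice l p y).trans ?_
    rw [h, map_smul]
    exact mul_comm _ _

variable [Module.Finite k H]

/-- The functional `x ↦ tr (y ↦ S²(p(y₍₁₎) y₍₂₎) x)`, a right integral in `H*`. -/
def average (p : H →ₗ[k] k) : H →ₗ[k] k :=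
  ∑ j, (finBasis k H).coord j ∘ₗ
    LinearMap.mulLeft k (antipode k (antipode k (slice p (finBasis k H j))))

theorem isRightIntegralDual_average (p : H →ₗ[k] k) : IsRightIntegralDual (average p) := by
  rw [isRightIntegralDual_iff]
  intro y
  set b := finBasis k H with hb
  let T : H →ₗ[k] H := LinearMap.mulRight k y ∘ₗ antipode k ∘ₗ antipode k ∘ₗ slice p
  have hsum : slice (average p) y = ∑ i, slice (b.coord i ∘ₗ
      LinearMap.mulLeft k (antipode k (antipode k (slice p (b i))))) y := by
    have : ∀ f : Fin (finrank k H) → (H →ₗ[k] k),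
        (∑ i, f i).rTensor H = ∑ i, (f i).rTensor H := fun f =>
      map_sum (LinearMap.rTensorHom H) f Finset.univ
    simp [slice, average, this, hb]
  let G : Fin (finrank k H) → H ⊗[k] H →ₗ[k] H := fun i =>
    LinearMap.mul' k H ∘ₗ TensorProduct.map (antipode k) (slice (b.coord i) ∘ₗ T) ∘ₗ
      (TensorProduct.comm k H H).toLinearMap
  have h1 : ∀ i, slice (b.coord i ∘ₗ
      LinearMap.mulLeft k (antipode k (antipode k (slice p (b i))))) y = G i (comul (b i)) := by
    intro i
    rw [slice_comp_mulLeft, comul_antipode, comul_slice]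
    generalize comul (R := k) (b i) = t
    induction t with
    | zero => simp
    | add s t hs ht => simp only [map_add, hs, ht]
    | tmul l r => simp [G, T]
  -- expand `slice (b.coord i) (T l)` along the basis
  let K : Fin (finrank k H) → H ⊗[k] (H ⊗[k] H) →ₗ[k] H := fun j =>
    (TensorProduct.lid k H).toLinearMap ∘ₗ TensorProduct.map (b.coord j ∘ₗ T)
      (LinearMap.mul' k H ∘ₗ (antipode k).rTensor H)
  have h2 : ∀ i (t : H ⊗[k] H), G i t = ∑ j, K j
      (TensorProduct.assoc k H H H (t ⊗ₜ[k] slice (b.coord i) (b j))) := by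
    intro i t
    induction t with
    | zero => simp
    | add s t hs ht =>
      simp only [map_add, hs, ht, TensorProduct.add_tmul, Finset.sum_add_distrib]
    | tmul l r =>
      have : slice (b.coord i) (T l) = ∑ j, b.repr (T l) j • slice (b.coord i) (b j) := by
        conv_lhs => rw [← b.sum_repr (T l), map_sum]
        simp
      simp [G, K, this, Finset.mul_sum]
  have h3 : ∀ j, ∑ i, K j (TensorProduct.assoc k H H H
      (comul (b i) ⊗ₜ[k] slice (b.coord i) (b j))) = b.repr (T (b j)) j • (1 : H) := by
    intro j
    have e1 : ∑ i, comul (R := k) (b i) ⊗ₜ[k] slice (b.coord i) (b j) =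
        comul.rTensor H (comul (R := k) (b j)) := by
      rw [← sum_tmul_slice b (b j), map_sum]
      simp
    rw [← map_sum, ← map_sum, e1, Coalgebra.coassoc_apply]
    have e2 : ∀ t : H ⊗[k] H, K j (comul.lTensor H t) =
        TensorProduct.lid k H (TensorProduct.map (b.coord j ∘ₗ T) (Algebra.linearMap k H)
          (counit.lTensor H t)) := by
      intro t
      induction t with
      | zero => simp
      | add s t hs ht => simp only [map_add, hs, ht]
      | tmul l r =>
        have := mul_antipode_rTensor_comul_apply (R := k) r
        simp [K, this]
    rw [e2]
    simp
  rw [hsum, Finset.sum_congr rfl fun i _ => (h1 i).trans (h2 i _), Finset.sum_comm,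
    Finset.sum_congr rfl fun j _ => h3 j, ← Finset.sum_smul]
  simp [average, T, hb]

/-- Every functional is recovered from its averages. -/
theorem sum_average (p : H →ₗ[k] k) (x : H) :
    ∑ i, average ((finBasis k H).coord i) (antipode k (slice p (finBasis k H i)) * x) = p x := by
  set b := finBasis k H with hb
  let L : Fin (finrank k H) → H ⊗[k] H →ₗ[k] k := fun j =>
    b.coord j ∘ₗ LinearMap.mulRight k x ∘ₗ antipode k ∘ₗ LinearMap.mul' k H ∘ₗ
      (antipode k).lTensor H
  have h1 : ∀ i, average (b.coord i) (antipode k (slice p (b i)) * x) =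
      ∑ j, L j (slice p (b i) ⊗ₜ[k] slice (b.coord i) (b j)) := by
    intro i
    simp [average, L, ← hb, antipode_mul_antidistrib, mul_assoc]
  have h2 : ∀ j, ∑ i, L j (slice p (b i) ⊗ₜ[k] slice (b.coord i) (b j)) =
      p (b j) * b.coord j x := by
    intro j
    have e1 : ∑ i, slice p (b i) ⊗ₜ[k] slice (b.coord i) (b j) = comul (slice p (b j)) := by
      rw [comul_slice, ← sum_tmul_slice b (b j), map_sum]
      simp
    rw [← map_sum, e1]
    simp only [L, LinearMap.comp_apply, mul_antipode_lTensor_comul_apply, counit_slice]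
    rw [Algebra.algebraMap_eq_smul_one]
    simp
  rw [Finset.sum_congr rfl fun i _ => h1 i, Finset.sum_comm,
    Finset.sum_congr rfl fun j _ => h2 j]
  conv_rhs => rw [← b.sum_repr x, map_sum]
  simp [mul_comm]

/-- The averages of `l(S(h) ·)`, for a right integral `l`. -/
theorem sum_average_smul {l : H →ₗ[k] k} (hl : IsRightIntegralDual l) (h z : H) :
    ∑ i, average ((finBasis k H).coord i) z •
      slice (l ∘ₗ LinearMap.mulLeft k (antipode k h)) (finBasis k H i) = l z • h := by
  set b := finBasis k H with hb
  rw [isRightIntegralDual_iff] at hl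
  set p := l ∘ₗ LinearMap.mulLeft k (antipode k h) with hp
  have hslice : ∀ y, slice p y = TensorProduct.rid k H
      ((l ∘ₗ LinearMap.mulRight k y ∘ₗ antipode k).lTensor H (comul h)) := by
    intro y
    rw [hp, slice_comp_mulLeft]
    generalize comul (R := k) h = t
    induction t with
    | zero => simp
    | add s t hs ht => simp only [map_add, hs, ht]
    | tmul u v => simp [hl]
  let M : Fin (finrank k H) → H ⊗[k] H →ₗ[k] H := fun j =>
    (TensorProduct.rid k H).toLinearMap ∘ₗ
      (b.coord j ∘ₗ LinearMap.mulRight k z ∘ₗ antipode k ∘ₗ antipode k).lTensor H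
  have h1 : ∀ i, average (b.coord i) z • slice p (b i) =
      ∑ j, M j (slice p (b i) ⊗ₜ[k] slice (b.coord i) (b j)) := by
    intro i
    simp [average, M, ← hb, Finset.sum_smul]
  let F : H ⊗[k] (H ⊗[k] H) →ₗ[k] H :=
    (TensorProduct.rid k H).toLinearMap ∘ₗ
      (l ∘ₗ LinearMap.mulRight k z ∘ₗ antipode k ∘ₗ LinearMap.mul' k H ∘ₗ
        (antipode k).rTensor H).lTensor H
  have h2 : ∑ j, M j (comul (slice p (b j))) = F (comul.lTensor H (comul h)) := by
    rw [← Coalgebra.coassoc_apply]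
    have : ∀ t : H ⊗[k] H, ∑ j, M j (comul (TensorProduct.rid k H
        ((l ∘ₗ LinearMap.mulRight k (b j) ∘ₗ antipode k).lTensor H t))) =
        F (TensorProduct.assoc k H H H (comul.rTensor H t)) := by
      intro t
      induction t with
      | zero => simp
      | add s t hs ht => simp only [map_add, Finset.sum_add_distrib, hs, ht]
      | tmul u v =>
        simp only [LinearMap.lTensor_tmul, TensorProduct.rid_tmul, map_smul,
          LinearMap.rTensor_tmul]
        generalize comul (R := k) u = s
        induction s with
        | zero => simp
        | add s t hs ht =>
          simp only [map_add, smul_add, Finset.sum_add_distrib, TensorProduct.add_tmul, hs, ht]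
        | tmul c d =>
          have e : l (antipode k v * (antipode k (antipode k d) * z)) =
              ∑ j, b.repr (antipode k (antipode k d) * z) j * l (antipode k v * b j) := by
            conv_lhs => rw [← b.sum_repr (antipode k (antipode k d) * z), Finset.mul_sum, map_sum]
            exact Finset.sum_congr rfl fun j _ => by rw [mul_smul_comm, map_smul, smul_eq_mul]
          simp [M, F, antipode_mul_antidistrib, mul_assoc, e, Finset.sum_smul, smul_smul, mul_comm]
    simp only [hslice]
    exact this _
  have h3 : ∀ j, ∑ i, M j (slice p (b i) ⊗ₜ[k] slice (b.coord i) (b j)) =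
      M j (comul (slice p (b j))) := by
    intro j
    rw [comul_slice, ← sum_tmul_slice b (b j), map_sum, map_sum]
    simp
  rw [Finset.sum_congr rfl fun i _ => h1 i, Finset.sum_comm,
    Finset.sum_congr rfl fun j _ => h3 j, h2]
  have h4 : ∀ t : H ⊗[k] H, F (comul.lTensor H t) =
      l z • TensorProduct.rid k H (counit.lTensor H t) := by
    intro t
    induction t with
    | zero => simp
    | add s t hs ht => simp only [map_add, hs, ht, smul_add]
    | tmul u v =>
      have := mul_antipode_rTensor_comul_apply (R := k) v
      simp [F, this, Algebra.algebraMap_eq_smul_one, smul_smul, mul_comm]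
  rw [h4]
  simp

theorem exists_rightIntegralDual : ∃ l : H →ₗ[k] k, l ≠ 0 ∧ IsRightIntegralDual l := by
  by_contra! hcon
  have h0 : ∀ p : H →ₗ[k] k, average p = 0 := fun p => by
    by_contra h
    exact hcon _ h (isRightIntegralDual_average p)
  have := sum_average (counit : H →ₗ[k] k) 1
  simp [h0] at this

theorem rightIntegralDual_bijective {l : H →ₗ[k] k} (hl0 : l ≠ 0) (hl : IsRightIntegralDual l) :
    Function.Bijective ((LinearMap.mul k H).compr₂ l ∘ₗ antipode k) := by
  have hinj : Function.Injective ((LinearMap.mul k H).compr₂ l ∘ₗ antipode k) := by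
    rw [injective_iff_map_eq_zero]
    intro h hh
    obtain ⟨z, hz⟩ : ∃ z, l z ≠ 0 := by
      by_contra! hc
      exact hl0 (LinearMap.ext hc)
    have h1 : l ∘ₗ LinearMap.mulLeft k (antipode k h) = 0 := by
      ext x
      simpa using LinearMap.congr_fun hh x
    have h2 := sum_average_smul hl h z
    rw [h1] at h2
    simp only [slice, LinearMap.rTensor_zero, LinearMap.zero_comp, LinearMap.comp_zero,
      LinearMap.zero_apply, smul_zero, Finset.sum_const_zero] at h2
    exact (smul_eq_zero.1 h2.symm).resolve_left hz
  refine ⟨hinj, (LinearMap.injective_iff_surjective_of_finrank_eq_finrank ?_).1 hinj⟩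
  exact Subspace.dual_finrank_eq.symm

/-- Right integrals in `H*` are unique up to scalars. -/
theorem rightIntegralDual_unique {l l' : H →ₗ[k] k} (hl0 : l ≠ 0) (hl : IsRightIntegralDual l)
    (hl' : IsRightIntegralDual l') : ∃ c : k, l' = c • l := by
  obtain ⟨h, hh⟩ := (rightIntegralDual_bijective hl0 hl).2 l'
  have h1 : l ∘ₗ LinearMap.mulLeft k (antipode k h) = l' ∘ₗ LinearMap.mulLeft k (antipode k 1) := by
    ext x
    simpa using LinearMap.congr_fun hh x
  obtain ⟨z, hz⟩ : ∃ z, l z ≠ 0 := by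
    by_contra! hc
    exact hl0 (LinearMap.ext hc)
  have h2 := sum_average_smul hl h z
  rw [h1, sum_average_smul hl' 1 z] at h2
  have h3 : h = ((l z)⁻¹ * l' z) • (1 : H) := by
    rw [mul_smul, h2, smul_smul, inv_mul_cancel₀ hz, one_smul]
  refine ⟨(l z)⁻¹ * l' z, ?_⟩
  rw [h3] at hh
  ext x
  have h4 := LinearMap.congr_fun hh x
  simp only [LinearMap.comp_apply, map_smul, antipode_one, LinearMap.smul_apply,
    LinearMap.compr₂_apply, LinearMap.mul_apply', one_mul] at h4
  exact h4.symm

/-- `Λ` is a left integral in `H`. -/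
def IsLeftIntegral (k : Type u) {H : Type u} [Field k] [Ring H] [HopfAlgebra k H] (Λ : H) : Prop :=
  ∀ h : H, h * Λ = (counit h : k) • Λ

/-- A nonzero left integral `Λ` exists and is unique up to scalars. -/
theorem exists_leftIntegral : ∃ Λ : H, Λ ≠ 0 ∧ IsLeftIntegral k Λ ∧
    ∀ Λ' : H, IsLeftIntegral k Λ' → ∃ c : k, Λ' = c • Λ := by
  obtain ⟨l, hl0, hl⟩ := exists_rightIntegralDual (k := k) (H := H)
  have hb := rightIntegralDual_bijective hl0 hl
  -- the functionals `l(h ·)` exhaust the dual, hence `x ↦ l(· x)` is injective, hence bijective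
  have hinj : Function.Injective ((LinearMap.mul k H).compr₂ l).flip := by
    rw [injective_iff_map_eq_zero]
    intro x hx
    rw [← Module.forall_dual_apply_eq_zero_iff k]
    intro f
    obtain ⟨h, rfl⟩ := hb.2 f
    simpa using LinearMap.congr_fun hx (antipode k h)
  have hsurj := (LinearMap.injective_iff_surjective_of_finrank_eq_finrank
    (Subspace.dual_finrank_eq (K := k) (V := H)).symm).1 hinj
  obtain ⟨Λ, hΛ⟩ := hsurj (counit : H →ₗ[k] k)
  have hΛ' : ∀ x, l (x * Λ) = counit (R := k) x := fun x => by
    simpa using LinearMap.congr_fun hΛ x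
  have hint : IsLeftIntegral k Λ := by
    intro h
    apply hinj
    ext x
    simp [← mul_assoc, hΛ', mul_comm]
  refine ⟨Λ, ?_, hint, fun Λ' h' => ⟨l Λ', ?_⟩⟩
  · rintro rfl
    simpa using hΛ' 1
  · apply hinj
    ext x
    simp [h' x, hΛ', mul_comm]

/-- `α` is the distinguished grouplike element `α_H` of `H*`: `Λ h = α(h) Λ` for all `h`, where
`Λ` is a nonzero left integral in `H`. -/
def IsDistinguishedChar (α : H →ₐ[k] k) : Prop :=
  ∃ Λ : H, Λ ≠ 0 ∧ IsLeftIntegral k Λ ∧ ∀ h : H, Λ * h = α h • Λ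

/-- `g` is the distinguished grouplike element `g_H` of `H`: `p l = p(g) l` for all `p ∈ H*`,
where `l` is a nonzero right integral in `H*`. -/
def IsDistinguishedGrouplike (g : GroupLike k H) : Prop :=
  ∃ l : H →ₗ[k] k, l ≠ 0 ∧ IsRightIntegralDual l ∧
    ∀ p : H →ₗ[k] k, WithConv.toConv p * WithConv.toConv l = p g.val • WithConv.toConv l

theorem existsUnique_distinguishedChar : ∃! α : H →ₐ[k] k, IsDistinguishedChar α := by
  obtain ⟨Λ, h0, hΛ, huniq⟩ := exists_leftIntegral (k := k) (H := H)
  have hex : ∀ h : H, ∃ c : k, Λ * h = c • Λ := fun h =>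
    huniq _ fun x => by rw [← mul_assoc, hΛ x, smul_mul_assoc]
  choose α hα using hex
  have hinj : ∀ c d : k, c • Λ = d • Λ → c = d := fun c d h => smul_left_injective k h0 h
  refine ⟨AlgHom.ofLinearMap
    { toFun := α
      map_add' := fun x y => hinj _ _ (by rw [← hα, mul_add, hα, hα, add_smul])
      map_smul' := fun c x => hinj _ _ (by
        rw [← hα, mul_smul_comm, hα, smul_smul, RingHom.id_apply, smul_eq_mul]) }
    (hinj _ _ (by simp [← hα])) (fun x y => hinj _ _ (by
      show α (x * y) • Λ = (α x * α y) • Λ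
      rw [← hα, ← mul_assoc, hα, smul_mul_assoc, hα, smul_smul])), ⟨Λ, h0, hΛ, hα⟩, ?_⟩
  rintro β ⟨Λ', h0', hΛ', hβ⟩
  obtain ⟨c, rfl⟩ := huniq Λ' hΛ'
  ext h
  have h1 := hβ h
  rw [smul_mul_assoc, hα, smul_comm] at h1
  exact (smul_left_injective k h0' h1).symm

theorem existsUnique_distinguishedGrouplike :
    ∃! g : GroupLike k H, IsDistinguishedGrouplike g := by
  obtain ⟨l, h0, hl⟩ := exists_rightIntegralDual (k := k) (H := H)
  have h0' : WithConv.toConv l ≠ 0 := fun h => h0 (WithConv.toConv_injective h)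
  have hex : ∀ p : H →ₗ[k] k, ∃ c : k,
      WithConv.toConv p * WithConv.toConv l = c • WithConv.toConv l := by
    intro p
    have : IsRightIntegralDual (WithConv.toConv p * WithConv.toConv l).ofConv := by
      intro q
      rw [WithConv.toConv_ofConv, mul_assoc, hl q, mul_smul_comm]
    obtain ⟨c, hc⟩ := rightIntegralDual_unique h0 hl this
    exact ⟨c, WithConv.ofConv_injective hc⟩
  choose c hc using hex
  have hinj : ∀ x y : k, x • WithConv.toConv l = y • WithConv.toConv l → x = y :=
    fun x y h => smul_left_injective k h0' h
  let C : Dual k (Dual k H) :=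
    { toFun := c
      map_add' := fun p q => hinj _ _ (by
        rw [← hc, add_smul, ← hc, ← hc, ← add_mul]; rfl)
      map_smul' := fun a p => hinj _ _ (by
        rw [← hc, RingHom.id_apply, smul_eq_mul, mul_smul, ← hc, ← smul_mul_assoc]; rfl) }
  set g : H := (evalEquiv k H).symm C with hg
  have hgc : ∀ p : Dual k H, c p = p g := fun p => by
    have : evalEquiv k H g = C := by simp [hg]
    exact (LinearMap.congr_fun this p).symm
  have hmul : ∀ p q : Dual k H, q (slice p g) = p g * q g := by
    intro p q
    rw [← conv_eq_slice]
    have h1 := hgc (WithConv.toConv p * WithConv.toConv q).ofConv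
    refine h1.symm.trans (hinj _ _ ?_)
    rw [← hc, WithConv.toConv_ofConv, mul_assoc, hc, mul_smul_comm, hc, smul_smul, hgc, hgc,
      mul_comm]
  have hslice : ∀ p : Dual k H, slice p g = p g • g := by
    intro p
    rw [← sub_eq_zero, ← Module.forall_dual_apply_eq_zero_iff k]
    intro q
    rw [map_sub, hmul, map_smul, smul_eq_mul, sub_self]
  have hgl : IsGroupLikeElem k g := by
    refine ⟨?_, ?_⟩
    · rw [← hgc]
      apply hinj
      rw [← hc, one_smul]
      exact one_mul (WithConv.toConv l)
    · rw [← sum_tmul_slice (finBasis k H) g]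
      simp only [hslice, ← TensorProduct.smul_tmul]
      rw [← TensorProduct.sum_tmul]
      congr 1
      exact (finBasis k H).sum_repr g
  refine ⟨⟨g, hgl⟩, ⟨l, h0, hl, fun p => by rw [hc, hgc]⟩, ?_⟩
  rintro ⟨g', hg'⟩ ⟨l', h0'', hl', h'⟩
  obtain ⟨d, rfl⟩ := rightIntegralDual_unique h0 hl hl'
  apply GroupLike.val_injective
  show g' = g
  rw [← sub_eq_zero, ← Module.forall_dual_apply_eq_zero_iff k]
  intro p
  have h1 := h' p
  have h2 : WithConv.toConv (d • l) ≠ 0 := fun h => h0'' (WithConv.toConv_injective h)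
  have h3 : WithConv.toConv p * WithConv.toConv (d • l) = p g • WithConv.toConv (d • l) := by
    rw [WithConv.toConv_smul, mul_smul_comm, hc, hgc, smul_comm]
  rw [map_sub, sub_eq_zero]
  exact smul_left_injective k h2 (h1.symm.trans h3)

variable (k H)

/-- The distinguished grouplike element `α_H` of `H*`. -/
def distinguishedChar : H →ₐ[k] k :=
  (existsUnique_distinguishedChar (k := k) (H := H)).choose

theorem distinguishedChar_spec : IsDistinguishedChar (distinguishedChar k H) :=
  (existsUnique_distinguishedChar (k := k) (H := H)).choose_spec.1

/-- The distinguished grouplike element `g_H` of `H`. -/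
def distinguishedGrouplike : GroupLike k H :=
  (existsUnique_distinguishedGrouplike (k := k) (H := H)).choose

theorem distinguishedGrouplike_spec : IsDistinguishedGrouplike (distinguishedGrouplike k H) :=
  (existsUnique_distinguishedGrouplike (k := k) (H := H)).choose_spec.1

/-! ### The distinguished invertible object and the Radford isomorphism -/

/-- The inverse `χ⁻¹ = χ ∘ S` of a character in the group of grouplikes of `H*`. -/
def charInv {k H : Type u} [Field k] [Ring H] [HopfAlgebra k H] (χ : H →ₐ[k] k) : H →ₐ[k] k :=
  AlgHom.ofLinearMap (χ.toLinearMap ∘ₗ antipode k) (by simp)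
    (fun x y => by simp [antipode_mul_antidistrib, mul_comm])

theorem charInv_apply {k H : Type u} [Field k] [Ring H] [HopfAlgebra k H] (χ : H →ₐ[k] k) (h : H) :
    charInv χ h = χ (antipode k h) := rfl

/-- `charInv` is the two-sided inverse for the convolution product. -/
theorem charInv_mul_cancel {k H : Type u} [Field k] [Ring H] [HopfAlgebra k H] (χ : H →ₐ[k] k) :
    WithConv.toConv (charInv χ) * WithConv.toConv χ = 1 ∧
      WithConv.toConv χ * WithConv.toConv (charInv χ) = 1 := by
  constructor
  · apply WithConv.ofConv_injective
    ext h
    have h1 : ∀ t : H ⊗[k] H, Algebra.TensorProduct.lift (charInv χ) χ (fun _ _ => .all ..) t =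
        χ (LinearMap.mul' k H ((antipode k).rTensor H t)) := by
      intro t
      induction t with
      | zero => simp
      | add s t hs ht => simp only [map_add, hs, ht]
      | tmul u v => simp [charInv_apply]
    refine (AlgHom.convMul_apply _ _ h).trans ((h1 _).trans ?_)
    rw [mul_antipode_rTensor_comul_apply]
    simp
  · apply WithConv.ofConv_injective
    ext h
    have h1 : ∀ t : H ⊗[k] H, Algebra.TensorProduct.lift χ (charInv χ) (fun _ _ => .all ..) t =
        χ (LinearMap.mul' k H ((antipode k).lTensor H t)) := by
      intro t
      induction t with
      | zero => simp
      | add s t hs ht => simp only [map_add, hs, ht]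
      | tmul u v => simp [charInv_apply]
    refine (AlgHom.convMul_apply _ _ h).trans ((h1 _).trans ?_)
    rw [mul_antipode_lTensor_comul_apply]
    simp

/-- The distinguished invertible object `D` of the category of `H`-modules: the one-dimensional
module with `h · d = α_H⁻¹(h) d`. -/
abbrev distinguishedObj : FDMod k H := FDMod.ofChar (charInv (distinguishedChar k H))

/-- The Radford isomorphism `ξ_D(X) : D ⊗ X → X**** ⊗ D`, `d ⊗ x ↦ g_H x ⊗ d`, where the space
`X` is identified with `X****` by evaluation. -/
def radfordIso (X : FDMod k H) :
    distinguishedObj k H ⊗[k] X →ₗ[k]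
      Dual k (Dual k (Dual k (Dual k X))) ⊗[k] distinguishedObj k H :=
  (Dual.eval k (Dual k (Dual k X)) ∘ₗ Dual.eval k X ∘ₗ
      X.ρ (distinguishedGrouplike k H).val).rTensor (distinguishedObj k H) ∘ₗ
    (TensorProduct.comm k (distinguishedObj k H) X).toLinearMap

/-- The objects of which `Sqrt(D, ξ_D)` consists, for the category of finite-dimensional
`H`-modules. -/
abbrev ShimizuSqrtObj : Type (u + 1) := SqrtObj (distinguishedObj k H) (radfordIso k H)

/-- Shimizu's set `Sqrt(D, ξ_D)` for the category of finite-dimensional `H`-modules. -/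
abbrev ShimizuSqrt : Type (u + 1) := SqrtSet (distinguishedObj k H) (radfordIso k H)

/-! ### Kauffman–Radford pairs -/

/-- The map `h ↦ χ(h₍₁₎) f(h₍₂₎) ψ(h₍₃₎)`. -/
def sandwich {k H : Type u} [Field k] [Ring H] [HopfAlgebra k H] (χ : H →ₗ[k] k) (f : H →ₗ[k] H) (ψ : H →ₗ[k] k) :
    H →ₗ[k] H :=
  (TensorProduct.lid k H).toLinearMap ∘ₗ
    TensorProduct.map χ ((TensorProduct.rid k H).toLinearMap ∘ₗ TensorProduct.map f ψ) ∘ₗ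
    (comul (R := k) (A := H)).lTensor H ∘ₗ comul

/-- A pair `(ζ, a)` of grouplikes of `H*` and `H` such that `ζ² = α_H`, `a² = g_H` and
`S²(h) = ζ⁻¹(h₍₁₎) a h₍₂₎ a⁻¹ ζ(h₍₃₎)` for all `h`. -/
structure KRPair where
  ζ : H →ₐ[k] k
  a : GroupLike k H
  ζ_sq : WithConv.toConv ζ ^ 2 = WithConv.toConv (distinguishedChar k H)
  a_sq : a ^ 2 = distinguishedGrouplike k H
  antipode_sq : ∀ h : H, antipode k (antipode k h) =
    sandwich (charInv ζ).toLinearMap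
      (LinearMap.mulLeft k a.val ∘ₗ LinearMap.mulRight k (a⁻¹).val) ζ.toLinearMap h

end HopfRep

end

/-!
An invertible `H`-module `V` is one-dimensional, so `H` acts on it through a character `χ`, and a
natural isomorphism `σ X : V ⊗ X ≅ X** ⊗ V` amounts to a natural family of linear maps `t_X : X → X`
through `σ X (v ⊗ x) = t_X x ⊗ v`. Naturality along the maps `H → X`, `h ↦ h x`, out of the regular
module shows that `t_X` is the action of the single element `a = t_H 1`; compatibility of `σ` with
tensor products and the unit object says exactly that `a` is grouplike
(`ZObj.exists_isGivenBy`).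

That `σ X` is `H`-linear then reads `χ(h₍₁₎) a h₍₂₎ = S²(h₍₁₎) a χ(h₍₂₎)`, because `H` acts on `X**`
through `S²`. Convolving with `χ⁻¹` in `Hom(H, H)` turns this into the formula for `S²` in a
Kauffman–Radford pair with `ζ = χ⁻¹` (`antipode_sq_eq_sandwich_iff`). Any linear isomorphism
`ν : V** ⊗ V ≅ D` is `H`-linear if and only if `χ² = α_H⁻¹`, that is `ζ² = α_H`, and it satisfies the
square root condition if and only if `a² = g_H` (`ZObj.IsGivenBy.isSqrt_iff`).

Finally, `χ` and `a` are invariants of the equivalence class of `(V, σ)` and determine it among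
one-dimensional objects (`ZObj.IsGivenBy.of_equivalent`, `ZObj.IsGivenBy.equivalent`,
`ZObj.IsGivenBy.unique`), which gives the bijection.
-/

noncomputable section

namespace HopfRep

open Module HopfAlgebra Coalgebra

variable {k H : Type u} [Field k] [Ring H] [HopfAlgebra k H]

/-! ### Characters and the convolution algebra -/

theorem charInv_charInv (χ : H →ₐ[k] k) : charInv (charInv χ) = χ :=
  WithConv.toConv_injective
    (left_inv_eq_right_inv (charInv_mul_cancel (charInv χ)).1 (charInv_mul_cancel χ).1)

theorem character_antipode_antipode (χ : H →ₐ[k] k) (h : H) :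
    χ (antipode k (antipode k h)) = χ h :=
  DFunLike.congr_fun (charInv_charInv χ) h

/-- `ζ² = α` in terms of `χ = ζ⁻¹`. -/
theorem charInv_sq_eq_iff (χ α : H →ₐ[k] k) :
    WithConv.toConv (charInv χ) ^ 2 = WithConv.toConv α ↔
      WithConv.toConv χ * WithConv.toConv χ = WithConv.toConv (charInv α) := by
  obtain ⟨h1, h2⟩ := charInv_mul_cancel χ
  obtain ⟨h3, h4⟩ := charInv_mul_cancel α
  constructor
  · intro h
    refine left_inv_eq_right_inv (a := WithConv.toConv α) ?_ h4
    rw [← h, pow_two, mul_assoc, ← mul_assoc (WithConv.toConv χ) (WithConv.toConv (charInv χ)), h2,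
      one_mul, h2]
  · intro h
    refine left_inv_eq_right_inv (a := WithConv.toConv (charInv α)) ?_ h3
    rw [← h, pow_two, mul_assoc, ← mul_assoc (WithConv.toConv (charInv χ)) (WithConv.toConv χ), h1,
      one_mul, h1]

/-- The map `y ↦ y₍₁₎ p(y₍₂₎)`, the mirror image of `slice`. -/
def coslice (p : H →ₗ[k] k) : H →ₗ[k] H :=
  (TensorProduct.rid k H).toLinearMap ∘ₗ p.lTensor H ∘ₗ comul

theorem character_mul_apply (χ ψ : H →ₐ[k] k) (h : H) :
    (WithConv.toConv χ * WithConv.toConv ψ).ofConv h = χ (coslice ψ.toLinearMap h) := by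
  have h1 : ∀ t : H ⊗[k] H, Algebra.TensorProduct.lift χ ψ (fun _ _ => .all ..) t =
      χ (TensorProduct.rid k H (ψ.toLinearMap.lTensor H t)) := by
    intro t
    induction t with
    | zero => simp
    | add s t hs ht => simp only [map_add, hs, ht]
    | tmul u v => simp [mul_comm]
  exact (AlgHom.convMul_apply _ _ h).trans (h1 _)

/-- The functional `p` as the map `h ↦ p(h) 1` in the convolution algebra `Hom(H, H)`. -/
def convScalar (p : H →ₗ[k] k) : WithConv (H →ₗ[k] H) :=
  WithConv.toConv (Algebra.linearMap k H ∘ₗ p)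

theorem convScalar_mul_apply (p : H →ₗ[k] k) (f : H →ₗ[k] H) (h : H) :
    (convScalar p * WithConv.toConv f).ofConv h = f (slice p h) := by
  have h1 : ∀ t : H ⊗[k] H, LinearMap.mul' k H
      (TensorProduct.map (Algebra.linearMap k H ∘ₗ p) f t) =
        f (TensorProduct.lid k H (p.rTensor H t)) := by
    intro t
    induction t with
    | zero => simp
    | add s t hs ht => simp only [map_add, hs, ht]
    | tmul u v => simp [Algebra.algebraMap_eq_smul_one]
  exact h1 _

theorem mul_convScalar_apply (p : H →ₗ[k] k) (f : H →ₗ[k] H) (h : H) :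
    (WithConv.toConv f * convScalar p).ofConv h = f (coslice p h) := by
  have h1 : ∀ t : H ⊗[k] H, LinearMap.mul' k H
      (TensorProduct.map f (Algebra.linearMap k H ∘ₗ p) t) =
        f (TensorProduct.rid k H (p.lTensor H t)) := by
    intro t
    induction t with
    | zero => simp
    | add s t hs ht => simp only [map_add, hs, ht]
    | tmul u v => simp [Algebra.algebraMap_eq_smul_one]
  exact h1 _

theorem sandwich_eq_convMul (p : H →ₗ[k] k) (f : H →ₗ[k] H) (q : H →ₗ[k] k) :
    sandwich p f q = (convScalar p * (WithConv.toConv f * convScalar q)).ofConv := by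
  ext h
  have h1 : ∀ t : H ⊗[k] H, TensorProduct.lid k H (TensorProduct.map p
      ((TensorProduct.rid k H).toLinearMap ∘ₗ TensorProduct.map f q) (comul.lTensor H t)) =
      (WithConv.toConv f * convScalar q).ofConv (TensorProduct.lid k H (p.rTensor H t)) := by
    intro t
    induction t with
    | zero => simp
    | add s t hs ht => simp only [map_add, hs, ht]
    | tmul u v =>
      have h2 : ∀ s : H ⊗[k] H, TensorProduct.rid k H (TensorProduct.map f q s) =
          f (TensorProduct.rid k H (q.lTensor H s)) := by
        intro s
        induction s with
        | zero => simp
        | add s t hs ht => simp only [map_add, hs, ht]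
        | tmul a b => simp
      rw [LinearMap.lTensor_tmul, TensorProduct.map_tmul, LinearMap.comp_apply,
        LinearEquiv.coe_coe, h2, LinearMap.rTensor_tmul, TensorProduct.lid_tmul,
        TensorProduct.lid_tmul, map_smul, mul_convScalar_apply]
      rfl
  exact (h1 _).trans (convScalar_mul_apply p _ h).symm

theorem convScalar_mul_charInv (χ : H →ₐ[k] k) :
    convScalar χ.toLinearMap * convScalar (charInv χ).toLinearMap = 1 ∧
      convScalar (charInv χ).toLinearMap * convScalar χ.toLinearMap = 1 := by
  constructor
  · apply WithConv.ofConv_injective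
    have h1 := LinearMap.algHom_comp_convMul_distrib ((Algebra.ofId k H).comp χ)
      (WithConv.toConv (LinearMap.id : H →ₗ[k] H)) (WithConv.toConv (antipode k (A := H)))
    rw [LinearMap.id_mul_antipode] at h1
    refine Eq.trans h1.symm ?_
    ext x
    simp
  · apply WithConv.ofConv_injective
    have h1 := LinearMap.algHom_comp_convMul_distrib ((Algebra.ofId k H).comp χ)
      (WithConv.toConv (antipode k (A := H))) (WithConv.toConv (LinearMap.id : H →ₗ[k] H))
    rw [LinearMap.antipode_mul_id] at h1
    refine Eq.trans h1.symm ?_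
    ext x
    simp

/-- The formula for `S²` as the intertwining relation
`χ(h₍₁₎) a h₍₂₎ = S²(h₍₁₎) a χ(h₍₂₎)`: the two differ by convolution with `χ⁻¹` on the right and
multiplication by `a⁻¹`. -/
theorem antipode_sq_eq_sandwich_iff (χ : H →ₐ[k] k) (a : GroupLike k H) :
    (∀ h : H, antipode k (antipode k h) = sandwich χ.toLinearMap
      (LinearMap.mulLeft k a.val ∘ₗ LinearMap.mulRight k (a⁻¹).val) (charInv χ).toLinearMap h) ↔
    ∀ h : H, a.val * slice χ.toLinearMap h =
      antipode k (antipode k (coslice χ.toLinearMap h)) * a.val := by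
  obtain ⟨h1, h2⟩ := convScalar_mul_charInv χ
  set F : H →ₗ[k] H := LinearMap.mulLeft k a.val ∘ₗ LinearMap.mulRight k (a⁻¹).val
  have ha : (a⁻¹).val * a.val = 1 := a.2.antipode_mul_cancel
  have ha' : a.val * (a⁻¹).val = 1 := a.2.mul_antipode_cancel
  have e1 : (∀ h : H, antipode k (antipode k h) = sandwich χ.toLinearMap F
      (charInv χ).toLinearMap h) ↔
      WithConv.toConv (antipode k ∘ₗ antipode k) = convScalar χ.toLinearMap *
        (WithConv.toConv F * convScalar (charInv χ).toLinearMap) := by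
    rw [sandwich_eq_convMul]
    exact ⟨fun h => WithConv.ofConv_injective (LinearMap.ext h),
      fun h x => LinearMap.congr_fun (congrArg WithConv.ofConv h) x⟩
  have e2 : (∀ h : H, a.val * slice χ.toLinearMap h =
      antipode k (antipode k (coslice χ.toLinearMap h)) * a.val) ↔
      convScalar χ.toLinearMap * WithConv.toConv F =
        WithConv.toConv (antipode k ∘ₗ antipode k) * convScalar χ.toLinearMap := by
    constructor
    · intro h
      apply WithConv.ofConv_injective
      ext x
      rw [convScalar_mul_apply, mul_convScalar_apply]
      show a.val * (slice χ.toLinearMap x * (a⁻¹).val) = _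
      rw [← mul_assoc, h, mul_assoc, ha', mul_one]
      rfl
    · intro h x
      have h3 := LinearMap.congr_fun (congrArg WithConv.ofConv h) x
      rw [convScalar_mul_apply, mul_convScalar_apply] at h3
      replace h3 : a.val * (slice χ.toLinearMap x * (a⁻¹).val) =
        antipode k (antipode k (coslice χ.toLinearMap x)) := h3
      rw [← h3, mul_assoc, mul_assoc, ha, mul_one]
  rw [e1, e2]
  constructor
  · intro h
    rw [h, mul_assoc, mul_assoc, h2, mul_one]
  · intro h
    rw [← mul_assoc, h, mul_assoc, h1, mul_one]

/-! ### Modules on which `H` acts through a character -/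

/-- The action of `H` on `V` is multiplication by `χ`. -/
def FDMod.ActsBy (V : FDMod k H) (χ : H →ₐ[k] k) : Prop :=
  ∀ (h : H) (v : V), V.ρ h v = χ h • v

theorem dual_dual_ρ_eval (X : FDMod k H) (h : H) (x : X) :
    X.dual.dual.ρ h (Dual.eval k X x) = Dual.eval k X (X.ρ (antipode k (antipode k h)) x) :=
  rfl

/-- `H` acts on `V**` through `S²`, and every character is invariant under `S²`. -/
theorem FDMod.ActsBy.dual_dual {V : FDMod k H} {χ : H →ₐ[k] k} (hV : V.ActsBy χ) :
    V.dual.dual.ActsBy χ := by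
  intro h F
  obtain ⟨v, rfl⟩ := (evalEquiv k V).surjective F
  refine (dual_dual_ρ_eval V h v).trans ?_
  rw [hV, character_antipode_antipode, map_smul]
  rfl

/-- `h · (v ⊗ x) = v ⊗ χ(h₍₁₎) h₍₂₎ x`. -/
theorem FDMod.ActsBy.tensor_left {V : FDMod k H} {χ : H →ₐ[k] k} (hV : V.ActsBy χ)
    (X : FDMod k H) (h : H) (v : V) (x : X) :
    (V.tensor X).ρ h (v ⊗ₜ[k] x) = v ⊗ₜ[k] X.ρ (slice χ.toLinearMap h) x := by
  have h1 : ∀ t : H ⊗[k] H, Module.endTensorEndAlgHom (R := k) (S := k) (A := k) (M := V) (N := X)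
      (Algebra.TensorProduct.map V.ρ X.ρ t) (v ⊗ₜ[k] x) =
      v ⊗ₜ[k] X.ρ (TensorProduct.lid k H (χ.toLinearMap.rTensor H t)) x := by
    intro t
    induction t with
    | zero => simp
    | add s t hs ht => simp only [map_add, LinearMap.add_apply, TensorProduct.tmul_add, hs, ht]
    | tmul a b => simp [Module.endTensorEndAlgHom_apply, hV a v, TensorProduct.smul_tmul']
  exact h1 _

theorem FDMod.ActsBy.tensor_right {V : FDMod k H} {χ : H →ₐ[k] k} (hV : V.ActsBy χ)
    (X : FDMod k H) (h : H) (x : X) (v : V) :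
    (X.tensor V).ρ h (x ⊗ₜ[k] v) = X.ρ (coslice χ.toLinearMap h) x ⊗ₜ[k] v := by
  have h1 : ∀ t : H ⊗[k] H, Module.endTensorEndAlgHom (R := k) (S := k) (A := k) (M := X) (N := V)
      (Algebra.TensorProduct.map X.ρ V.ρ t) (x ⊗ₜ[k] v) =
      X.ρ (TensorProduct.rid k H (χ.toLinearMap.lTensor H t)) x ⊗ₜ[k] v := by
    intro t
    induction t with
    | zero => simp
    | add s t hs ht => simp only [map_add, LinearMap.add_apply, TensorProduct.add_tmul, hs, ht]
    | tmul a b => simp [Module.endTensorEndAlgHom_apply, hV b v, TensorProduct.smul_tmul']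
  exact h1 _

theorem tmul_left_injective {W V : Type*} [AddCommGroup W] [Module k W] [AddCommGroup V]
    [Module k V] {v : V} (hv : v ≠ 0) : Function.Injective fun w : W => w ⊗ₜ[k] v := by
  obtain ⟨f, hf⟩ := Module.Projective.exists_dual_ne_zero k hv
  intro w w' h
  have h1 := congrArg (fun t => TensorProduct.rid k W (f.lTensor W t)) h
  simp only [LinearMap.lTensor_tmul, TensorProduct.rid_tmul] at h1
  exact smul_right_injective W hf h1

/-- Over a field, the evaluation and the coevaluation of a one-dimensional space are nonzero maps
between one-dimensional spaces. -/
theorem FDMod.invertible_iff (V : FDMod k H) : V.Invertible ↔ finrank k V = 1 := by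
  constructor
  · rintro ⟨h, -⟩
    have h1 := (LinearEquiv.ofBijective _ h).finrank_eq
    rw [finrank_tensorProduct, Subspace.dual_finrank_eq, finrank_self] at h1
    exact Nat.eq_one_of_mul_eq_one_left h1
  · intro h
    have hd : finrank k (Dual k V) = 1 := by rw [Subspace.dual_finrank_eq, h]
    have : Nontrivial V := Module.nontrivial_of_finrank_pos (R := k) (by omega)
    obtain ⟨v, hv⟩ := exists_ne (0 : V)
    obtain ⟨f, hf⟩ := Module.Projective.exists_dual_ne_zero k hv
    constructor
    · have h1 : contractLeft k V ≠ 0 := fun h0 => hf (by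
        simpa using LinearMap.congr_fun h0 (f ⊗ₜ[k] v))
      have h2 := LinearMap.surjective h1
      have h3 : finrank k (Dual k V ⊗[k] V) = finrank k k := by
        rw [finrank_tensorProduct, h, hd, finrank_self]
      exact ⟨(LinearMap.injective_iff_surjective_of_finrank_eq_finrank (K := k)
        (V := Dual k V ⊗[k] V) (V₂ := k) h3).2 h2, h2⟩
    · have h1 : Function.Injective (coevaluation k V) := by
        rw [injective_iff_map_eq_zero]
        intro c hc
        by_contra hc0
        have h2 : coevaluation k V 1 = 0 := by
          have h3 : coevaluation k V (c⁻¹ • c) = 0 := by rw [map_smul, hc, smul_zero]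
          rwa [smul_eq_mul, inv_mul_cancel₀ hc0] at h3
        have h4 := contractLeft_assoc_coevaluation' k V
        have h5 := LinearMap.congr_fun h4 ((1 : k) ⊗ₜ[k] v)
        simp only [LinearMap.comp_apply, LinearMap.rTensor_tmul, h2, TensorProduct.zero_tmul,
          map_zero, LinearEquiv.coe_coe, TensorProduct.lid_tmul, one_smul] at h5
        have h6 := congrArg (TensorProduct.rid k V) h5
        simp at h6
        exact hv h6.symm
      refine ⟨h1, (LinearMap.injective_iff_surjective_of_finrank_eq_finrank ?_).1 h1⟩
      rw [finrank_tensorProduct, h, hd, finrank_self]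

theorem ddTensor_eval (X Y : Type u) [AddCommGroup X] [Module k X] [Module.Finite k X]
    [AddCommGroup Y] [Module k Y] [Module.Finite k Y] (x : X) (y : Y) :
    ddTensor X Y (Dual.eval k X x ⊗ₜ[k] Dual.eval k Y y) = Dual.eval k (X ⊗[k] Y) (x ⊗ₜ[k] y) := by
  have h1 : (evalEquiv k X).symm (Dual.eval k X x) = x := (evalEquiv k X).symm_apply_apply x
  have h2 : (evalEquiv k Y).symm (Dual.eval k Y y) = y := (evalEquiv k Y).symm_apply_apply y
  simp [ddTensor, h1, h2]

/-! ### Objects of `𝒵(Id, (-)**)` given by a character and a grouplike element -/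

/-- `H` acts on `V` through the character `χ`, and `σ X` is `v ⊗ x ↦ a x ⊗ v`. -/
structure ZObj.IsGivenBy (P : ZObj k H) (χ : H →ₐ[k] k) (a : H) : Prop where
  actsBy : P.V.ActsBy χ
  σ_tmul : ∀ (X : FDMod k H) (v : P.V) (x : X),
    P.σ X (v ⊗ₜ[k] x) = Dual.eval k X (X.ρ a x) ⊗ₜ[k] v

/-- The action of a grouplike element, as a linear automorphism of an `H`-module. -/
def FDMod.grouplikeEquiv (X : FDMod k H) (a : GroupLike k H) : X ≃ₗ[k] X :=
  LinearEquiv.ofLinearMap (X.ρ a.val) (X.ρ (a⁻¹).val)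
    (by
      have : a.val * (a⁻¹).val = 1 := a.2.mul_antipode_cancel
      rw [← Module.End.mul_eq_comp, ← map_mul, this, map_one]; rfl)
    (by
      have : (a⁻¹).val * a.val = 1 := a.2.antipode_mul_cancel
      rw [← Module.End.mul_eq_comp, ← map_mul, this, map_one]; rfl)

theorem tensor_ρ_grouplike (X Y : FDMod k H) (a : GroupLike k H) (x : X) (y : Y) :
    (X.tensor Y).ρ a.val (x ⊗ₜ[k] y) = X.ρ a.val x ⊗ₜ[k] Y.ρ a.val y := by
  show Module.endTensorEndAlgHom (Algebra.TensorProduct.map X.ρ Y.ρ (comul (R := k) a.val)) _ = _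
  rw [a.2.comul_eq_tmul_self]
  simp [Module.endTensorEndAlgHom_apply]

/-- The object `(k, σ)` of `𝒵(Id, (-)**)` given by a character `χ` and a grouplike element `a`
satisfying the intertwining relation. -/
def ZObj.ofPair (χ : H →ₐ[k] k) (a : GroupLike k H)
    (ha : ∀ h : H, a.val * slice χ.toLinearMap h =
      antipode k (antipode k (coslice χ.toLinearMap h)) * a.val) : ZObj k H where
  V := FDMod.ofChar χ
  σ X := (TensorProduct.comm k k X).trans
    (TensorProduct.congr ((X.grouplikeEquiv a).trans (evalEquiv k X)) (LinearEquiv.refl k k))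
  σ_hom X h t := by
    have hV : (FDMod.ofChar χ).ActsBy χ := fun _ _ => rfl
    induction t using TensorProduct.induction_on with
    | zero => rw [map_zero, map_zero, map_zero]
    | add s t hs ht => rw [map_add, map_add, map_add, map_add, hs, ht]
    | tmul v x =>
      rw [hV.tensor_left]
      show Dual.eval k X (X.ρ a.val (X.ρ (slice χ.toLinearMap h) x)) ⊗ₜ[k] v =
        (X.dual.dual.tensor (FDMod.ofChar χ)).ρ h (Dual.eval k X (X.ρ a.val x) ⊗ₜ[k] v)
      rw [hV.tensor_right, dual_dual_ρ_eval, ← Module.End.mul_apply, ← Module.End.mul_apply,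
        ← map_mul, ← map_mul, ha]
  σ_natural X Y f hf := by
    refine TensorProduct.ext' fun v x => ?_
    show Dual.eval k Y (Y.ρ a.val (f x)) ⊗ₜ[k] v = Dual.eval k Y (f (X.ρ a.val x)) ⊗ₜ[k] v
    rw [hf]
  σ_tensor X Y := by
    refine TensorProduct.ext' fun v t => ?_
    induction t using TensorProduct.induction_on with
    | zero => rw [TensorProduct.tmul_zero, map_zero, map_zero]
    | add s t hs ht => rw [TensorProduct.tmul_add, map_add, map_add, hs, ht]
    | tmul x y =>
      show Dual.eval k (X ⊗[k] Y) ((X.tensor Y).ρ a.val (x ⊗ₜ[k] y)) ⊗ₜ[k] v =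
        ddTensor X Y (Dual.eval k X (X.ρ a.val x) ⊗ₜ[k] Dual.eval k Y (Y.ρ a.val y)) ⊗ₜ[k] v
      rw [ddTensor_eval, tensor_ρ_grouplike]
  σ_unit v := by
    show Dual.eval k k (counit (R := k) a.val * 1) ⊗ₜ[k] v = _
    rw [a.2.counit_eq_one, mul_one]

theorem ZObj.ofPair_isGivenBy (χ : H →ₐ[k] k) (a : GroupLike k H)
    (ha : ∀ h : H, a.val * slice χ.toLinearMap h =
      antipode k (antipode k (coslice χ.toLinearMap h)) * a.val) :
    (ZObj.ofPair χ a ha).IsGivenBy χ a.val :=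
  ⟨fun _ _ => rfl, fun _ _ _ => rfl⟩

namespace ZObj.IsGivenBy

variable {P Q : ZObj k H} {χ χ' : H →ₐ[k] k} {a a' : H}

theorem of_equivalent (hP : P.IsGivenBy χ a) (h : P.Equivalent Q) : Q.IsGivenBy χ a := by
  obtain ⟨f, hf, hσ⟩ := h
  refine ⟨fun x w => ?_, fun X w x => ?_⟩
  · obtain ⟨v, rfl⟩ := f.surjective w
    have h1 := hf x v
    rw [hP.actsBy, map_smul] at h1
    exact h1.symm
  · obtain ⟨v, rfl⟩ := f.surjective w
    have h1 := LinearMap.congr_fun (hσ X) (v ⊗ₜ[k] x)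
    simp only [LinearMap.comp_apply, LinearMap.rTensor_tmul, LinearEquiv.coe_coe, hP.σ_tmul,
      LinearMap.lTensor_tmul] at h1
    exact h1

theorem equivalent (hP : P.IsGivenBy χ a) (hQ : Q.IsGivenBy χ a)
    (h : finrank k P.V = finrank k Q.V) : P.Equivalent Q := by
  let f := LinearEquiv.ofFinrankEq P.V Q.V h
  refine ⟨f, fun x v => ?_, fun X => TensorProduct.ext' fun v x => ?_⟩
  · rw [hP.actsBy, hQ.actsBy, map_smul]
  · simp only [LinearMap.comp_apply, LinearMap.rTensor_tmul, LinearEquiv.coe_coe, hP.σ_tmul,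
      LinearMap.lTensor_tmul, hQ.σ_tmul]

theorem σdd_eval (hP : P.IsGivenBy χ a) (X : FDMod k H) (v : P.V) (x : X) :
    P.σdd X (Dual.eval k P.V v ⊗ₜ[k] Dual.eval k X x) =
      Dual.eval k (Dual k (Dual k X)) (Dual.eval k X (X.ρ a x)) ⊗ₜ[k] Dual.eval k P.V v := by
  simp only [ZObj.σdd, LinearMap.comp_apply, LinearEquiv.coe_coe, ddTensor_eval]
  rw [LinearEquiv.symm_apply_eq]
  refine Eq.trans ?_ (ddTensor_eval (Dual k (Dual k X)) P.V _ v).symm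
  show Dual.eval k _ (P.σ X (v ⊗ₜ[k] x)) = _
  rw [hP.σ_tmul]

/-- The composite `(id ⊗ ν) (σ(X)** ⊗ id) (id ⊗ σ(X))` is `v ⊗ w ⊗ x ↦ a² x ⊗ ν(v ⊗ w)`. -/
theorem sqrt_comp_apply (hP : P.IsGivenBy χ a) {D : FDMod k H}
    (ν : Dual k (Dual k P.V) ⊗[k] P.V →ₗ[k] D) (X : FDMod k H) (v w : P.V) (x : X) :
      (ν.lTensor (Dual k (Dual k (Dual k (Dual k X)))) ∘ₗ
        (TensorProduct.assoc k (Dual k (Dual k (Dual k (Dual k X))))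
          (Dual k (Dual k P.V)) P.V).toLinearMap ∘ₗ
        (P.σdd X).rTensor P.V ∘ₗ
        (TensorProduct.assoc k (Dual k (Dual k P.V)) (Dual k (Dual k X)) P.V).symm.toLinearMap ∘ₗ
        (P.σ X).toLinearMap.lTensor (Dual k (Dual k P.V)) ∘ₗ
        (TensorProduct.assoc k (Dual k (Dual k P.V)) P.V X).toLinearMap)
        ((Dual.eval k P.V v ⊗ₜ[k] w) ⊗ₜ[k] x) =
        Dual.eval k (Dual k (Dual k X)) (Dual.eval k X (X.ρ (a * a) x)) ⊗ₜ[k]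
          ν (Dual.eval k P.V v ⊗ₜ[k] w) := by
  simp only [LinearMap.comp_apply, LinearEquiv.coe_coe, TensorProduct.assoc_tmul,
    LinearMap.lTensor_tmul, hP.σ_tmul, TensorProduct.assoc_symm_tmul, LinearMap.rTensor_tmul,
    hP.σdd_eval, map_mul, Module.End.mul_apply]
end ZObj.IsGivenBy

variable [Module.Finite k H]

variable (k H) in
/-- The left regular module. -/
abbrev FDMod.regular : FDMod k H where
  carrier := H
  ρ := Algebra.lmul k H

namespace ZObj.IsGivenBy

variable {P Q : ZObj k H} {χ χ' : H →ₐ[k] k} {a a' : H}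

theorem unique [Nontrivial P.V] (h : P.IsGivenBy χ a) (h' : P.IsGivenBy χ' a') :
    χ = χ' ∧ a = a' := by
  obtain ⟨v, hv⟩ := exists_ne (0 : P.V)
  constructor
  · ext x
    exact smul_left_injective k hv ((h.actsBy x v).symm.trans (h'.actsBy x v))
  · have h1 := (h.σ_tmul (FDMod.regular k H) v (1 : H)).symm.trans
      (h'.σ_tmul (FDMod.regular k H) v (1 : H))
    have h2 := (evalEquiv k H).injective (tmul_left_injective hv h1)
    simpa using h2

/-- The `H`-linearity of `σ` on the regular module is the intertwining relation between `χ` and `a`. -/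
theorem intertwine [Nontrivial P.V] (hP : P.IsGivenBy χ a) (h : H) :
    a * slice χ.toLinearMap h = antipode k (antipode k (coslice χ.toLinearMap h)) * a := by
  obtain ⟨v, hv⟩ := exists_ne (0 : P.V)
  have h1 := P.σ_hom (FDMod.regular k H) h (v ⊗ₜ[k] (1 : H))
  rw [hP.actsBy.tensor_left, LinearEquiv.coe_coe, hP.σ_tmul, hP.σ_tmul, hP.actsBy.tensor_right,
    dual_dual_ρ_eval] at h1
  have h2 := (evalEquiv k H).injective (tmul_left_injective hv h1)
  simpa using h2

end ZObj.IsGivenBy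

/-! ### One-dimensional objects of `𝒵(Id, (-)**)` -/

theorem tensor_regular_ρ_one (h : H) :
    ((FDMod.regular k H).tensor (FDMod.regular k H)).ρ h ((1 : H) ⊗ₜ[k] (1 : H)) = comul h := by
  have h1 : ∀ t : H ⊗[k] H, Module.endTensorEndAlgHom (R := k) (S := k) (A := k) (M := H) (N := H)
      (Algebra.TensorProduct.map (Algebra.lmul k H) (Algebra.lmul k H) t) (1 ⊗ₜ[k] 1) = t := by
    intro t
    induction t with
    | zero => simp
    | add s t hs ht => simp only [map_add, LinearMap.add_apply, hs, ht]
    | tmul a b => simp [Module.endTensorEndAlgHom_apply]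
  exact h1 _

/-- Over a one-dimensional `V`, the natural isomorphism `σ X` is `v ⊗ x ↦ t_X x ⊗ v` for a natural
family of linear maps `t_X`. Naturality along `H → X`, `h ↦ h x`, shows that `t_X` is the action of
`a = t_H 1`, and the compatibility of `σ` with tensor products and the unit object makes `a`
grouplike. -/
theorem ZObj.exists_isGivenBy (P : ZObj k H) (h1 : finrank k P.V = 1) :
    ∃ (χ : H →ₐ[k] k) (a : GroupLike k H), P.IsGivenBy χ a.val := by
  have : Nontrivial P.V := Module.nontrivial_of_finrank_pos (R := k) (by omega)
  obtain ⟨v₀, hv₀, hspan⟩ := finrank_eq_one_iff'.1 h1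
  obtain ⟨f, hf⟩ : ∃ f : Dual k P.V, f v₀ = 1 := by
    obtain ⟨f, hf⟩ := Module.Projective.exists_dual_ne_zero k hv₀
    exact ⟨(f v₀)⁻¹ • f, by simp [hf]⟩
  have hfv : ∀ w : P.V, w = f w • v₀ := by
    intro w
    obtain ⟨c, rfl⟩ := hspan w
    simp [hf]
  have hρ : ∀ h : H, P.V.ρ h v₀ = f (P.V.ρ h v₀) • v₀ := fun h => hfv _
  let χ : H →ₐ[k] k := AlgHom.ofLinearMap (f ∘ₗ LinearMap.applyₗ v₀ ∘ₗ P.V.ρ.toLinearMap)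
    (by simp [hf])
    (fun x y => by
      show f (P.V.ρ (x * y) v₀) = f (P.V.ρ x v₀) * f (P.V.ρ y v₀)
      rw [map_mul, Module.End.mul_apply, hρ y, map_smul, map_smul, smul_eq_mul, map_smul, hf,
        smul_eq_mul, mul_one, mul_comm])
  -- every element of `W ⊗ V` is a pure tensor with second factor `v₀`
  have hten : ∀ {W : Type u} [AddCommGroup W] [Module k W] (z : W ⊗[k] P.V),
      z = TensorProduct.rid k W (f.lTensor W z) ⊗ₜ[k] v₀ := by
    intro W _ _ z
    induction z with
    | zero => simp
    | add s t hs ht => conv_lhs => rw [hs, ht, ← TensorProduct.add_tmul, ← map_add, ← map_add]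
    | tmul w v =>
      conv_lhs => rw [hfv v, TensorProduct.tmul_smul, TensorProduct.smul_tmul']
      simp
  let t : ∀ X : FDMod k H, X →ₗ[k] X := fun X => (evalEquiv k X).symm.toLinearMap ∘ₗ
    (TensorProduct.rid k _).toLinearMap ∘ₗ f.lTensor _ ∘ₗ (P.σ X).toLinearMap ∘ₗ
      TensorProduct.mk k P.V X v₀
  have ht₀ : ∀ (X : FDMod k H) (x : X), P.σ X (v₀ ⊗ₜ[k] x) = Dual.eval k X (t X x) ⊗ₜ[k] v₀ := by
    intro X x
    refine (hten _).trans ?_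
    congr 1
    exact ((evalEquiv k X).apply_symm_apply _).symm
  have ht : ∀ (X : FDMod k H) (v : P.V) (x : X),
      P.σ X (v ⊗ₜ[k] x) = Dual.eval k X (t X x) ⊗ₜ[k] v := by
    intro X v x
    rw [hfv v, ← TensorProduct.smul_tmul', map_smul, ht₀, TensorProduct.tmul_smul]
  have hinj : ∀ (X : FDMod k H) (x y : X),
      Dual.eval k X x ⊗ₜ[k] v₀ = Dual.eval k X y ⊗ₜ[k] v₀ → x = y := fun X x y h =>
    (evalEquiv k X).injective (tmul_left_injective hv₀ h)
  have hnat : ∀ (X Y : FDMod k H) (g : X →ₗ[k] Y), IsHom X Y g → ∀ x, t Y (g x) = g (t X x) := by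
    intro X Y g hg x
    apply hinj
    have h2 := LinearMap.congr_fun (P.σ_natural X Y g hg) (v₀ ⊗ₜ[k] x)
    simp only [LinearMap.comp_apply, LinearMap.lTensor_tmul, LinearEquiv.coe_coe, ht,
      LinearMap.rTensor_tmul] at h2
    exact h2
  set a : H := t (FDMod.regular k H) (1 : H) with ha
  have hta : ∀ (X : FDMod k H) (x : X), t X x = X.ρ a x := by
    intro X x
    have h2 := hnat (FDMod.regular k H) X (LinearMap.applyₗ x ∘ₗ X.ρ.toLinearMap)
      (fun h y => by simp) (1 : H)
    simpa using h2
  have hgl : IsGroupLikeElem k a := by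
    refine ⟨?_, ?_⟩
    · have h2 := P.σ_unit v₀
      rw [ht, hta] at h2
      simpa using hinj FDMod.unit _ _ h2
    · have h2 := LinearMap.congr_fun (P.σ_tensor (FDMod.regular k H) (FDMod.regular k H))
        (v₀ ⊗ₜ[k] ((1 : H) ⊗ₜ[k] (1 : H)))
      simp only [LinearMap.comp_apply, LinearEquiv.coe_coe, TensorProduct.assoc_symm_tmul,
        LinearMap.rTensor_tmul, ht, TensorProduct.assoc_tmul, LinearMap.lTensor_tmul]
        at h2
      have h3 := hinj ((FDMod.regular k H).tensor (FDMod.regular k H)) _ _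
        (h2.trans (congrArg (· ⊗ₜ[k] v₀) (ddTensor_eval H H a a)))
      rw [hta, tensor_regular_ρ_one] at h3
      exact h3
  refine ⟨χ, ⟨a, hgl⟩, fun h v => ?_, fun X v x => ?_⟩
  · show P.V.ρ h v = f (P.V.ρ h v₀) • v
    conv_lhs => rw [hfv v, map_smul, hρ, smul_comm, ← hfv]
  · rw [ht, hta]

namespace ZObj.IsGivenBy

variable {P : ZObj k H} {χ : H →ₐ[k] k} {a : H}

theorem radfordIso_comp_apply (P : ZObj k H)
    (ν : Dual k (Dual k P.V) ⊗[k] P.V →ₗ[k] distinguishedObj k H) (X : FDMod k H)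
    (F : Dual k (Dual k P.V)) (w : P.V) (x : X) :
    (radfordIso k H X ∘ₗ ν.rTensor X) ((F ⊗ₜ[k] w) ⊗ₜ[k] x) =
      Dual.eval k (Dual k (Dual k X)) (Dual.eval k X (X.ρ (distinguishedGrouplike k H).val x)) ⊗ₜ[k]
        ν (F ⊗ₜ[k] w) :=
  rfl

/-- Both conditions on `ν` hold for one linear isomorphism `V** ⊗ V ≅ D` if and only if they hold
for all of them, so any `ν` serves as a witness. -/
theorem isSqrt_iff (hP : P.IsGivenBy χ a) (h1 : finrank k P.V = 1) :
    P.IsSqrt (distinguishedObj k H) (radfordIso k H) ↔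
      WithConv.toConv χ * WithConv.toConv χ = WithConv.toConv (charInv (distinguishedChar k H)) ∧
        a * a = (distinguishedGrouplike k H).val := by
  have hact : ∀ (h : H) (F : Dual k (Dual k P.V)) (v : P.V),
      (P.V.dual.dual.tensor P.V).ρ h (F ⊗ₜ[k] v) =
        (WithConv.toConv χ * WithConv.toConv χ).ofConv h • (F ⊗ₜ[k] v) := by
    intro h F v
    rw [hP.actsBy.tensor_right, hP.actsBy.dual_dual, character_mul_apply, TensorProduct.smul_tmul']
  constructor
  · rintro ⟨ν, hν, hsq⟩
    have : Nontrivial P.V := Module.nontrivial_of_finrank_pos (R := k) (by omega)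
    obtain ⟨v, hv⟩ := exists_ne (0 : P.V)
    have hd : ν (Dual.eval k P.V v ⊗ₜ[k] v) ≠ 0 := by
      rw [ne_eq, LinearEquiv.map_eq_zero_iff]
      intro h0
      have h2 : Dual.eval k P.V v = 0 :=
        tmul_left_injective hv (h0.trans (TensorProduct.zero_tmul _ v).symm)
      exact hv ((evalEquiv k P.V).map_eq_zero_iff.1 h2)
    constructor
    · apply WithConv.ofConv_injective
      ext h
      have h2 := hν h (Dual.eval k P.V v ⊗ₜ[k] v)
      rw [hact, map_smul] at h2
      exact mul_right_cancel₀ hd h2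
    · have h2 := LinearMap.congr_fun (hsq (FDMod.regular k H))
        ((Dual.eval k P.V v ⊗ₜ[k] v) ⊗ₜ[k] (1 : H))
      have h3 := (radfordIso_comp_apply P ν.toLinearMap (FDMod.regular k H) _ v (1 : H)).symm.trans
        (h2.trans (hP.sqrt_comp_apply ν.toLinearMap (FDMod.regular k H) v v (1 : H)))
      have h4 := (evalEquiv k H).injective
        ((evalEquiv k (Dual k (Dual k H))).injective (tmul_left_injective hd h3))
      simpa using h4.symm
  · rintro ⟨hχ, ha⟩
    have hdim : finrank k (Dual k (Dual k P.V) ⊗[k] P.V) = finrank k (distinguishedObj k H) := by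
      rw [finrank_tensorProduct, Subspace.dual_finrank_eq, Subspace.dual_finrank_eq, h1]
      exact (finrank_self k).symm
    let ν : Dual k (Dual k P.V) ⊗[k] P.V ≃ₗ[k] distinguishedObj k H :=
      LinearEquiv.ofFinrankEq _ _ hdim
    refine ⟨ν, fun h z => ?_, fun X => TensorProduct.ext' fun z x => ?_⟩
    · induction z using TensorProduct.induction_on with
      | zero => rw [map_zero, map_zero, map_zero]
      | add s t hs ht => rw [map_add, map_add, map_add, map_add, hs, ht]
      | tmul F v =>
        rw [hact, hχ, map_smul]
        rfl
    · induction z using TensorProduct.induction_on with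
      | zero => rw [TensorProduct.zero_tmul, map_zero, map_zero]
      | add s t hs ht => rw [TensorProduct.add_tmul, map_add, map_add, hs, ht]
      | tmul F w =>
        obtain ⟨v, rfl⟩ := (evalEquiv k P.V).surjective F
        refine (radfordIso_comp_apply P ν.toLinearMap X _ w x).trans
          (Eq.trans ?_ (hP.sqrt_comp_apply ν.toLinearMap X v w x).symm)
        rw [ha]
        rfl

end ZObj.IsGivenBy

/-! ### The bijection -/

namespace KRPair

theorem intertwine (p : KRPair k H) (h : H) :
    p.a.val * slice (charInv p.ζ).toLinearMap h =
      antipode k (antipode k (coslice (charInv p.ζ).toLinearMap h)) * p.a.val :=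
  (antipode_sq_eq_sandwich_iff (charInv p.ζ) p.a).1
    (by rw [charInv_charInv]; exact p.antipode_sq) h

/-- The square root `(V, σ)` of `(D, ξ_D)` given by `(ζ, a)`: `V = k` with the action `ζ⁻¹`, and
`σ X` is `v ⊗ x ↦ a x ⊗ v`. -/
def toSqrtObj (p : KRPair k H) : ShimizuSqrtObj k H :=
  ⟨ZObj.ofPair (charInv p.ζ) p.a p.intertwine,
    (FDMod.invertible_iff _).2 (finrank_self k),
    ((ZObj.ofPair_isGivenBy _ _ p.intertwine).isSqrt_iff (finrank_self k)).2
      ⟨(charInv_sq_eq_iff _ _).1 (by rw [charInv_charInv]; exact p.ζ_sq),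
        by rw [← p.a_sq, pow_two]; rfl⟩⟩

theorem toSqrtObj_isGivenBy (p : KRPair k H) :
    p.toSqrtObj.1.IsGivenBy (charInv p.ζ) p.a.val :=
  ZObj.ofPair_isGivenBy _ _ p.intertwine

end KRPair

/-- The assignment of classes to pairs is onto: every square root is given by some pair. -/
theorem ShimizuSqrtObj.exists_isGivenBy (P : ShimizuSqrtObj k H) :
    ∃ p : KRPair k H, P.1.IsGivenBy (charInv p.ζ) p.a.val := by
  obtain ⟨P, hinv, hsq⟩ := P
  have h1 := (FDMod.invertible_iff _).1 hinv
  have : Nontrivial P.V := Module.nontrivial_of_finrank_pos (R := k) (by omega)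
  obtain ⟨χ, a, hP⟩ := P.exists_isGivenBy h1
  obtain ⟨hχ, ha⟩ := (hP.isSqrt_iff h1).1 hsq
  refine ⟨⟨charInv χ, a, (charInv_sq_eq_iff χ _).2 hχ, GroupLike.val_injective ?_, ?_⟩, ?_⟩
  · rw [← ha, pow_two]
    rfl
  · rw [charInv_charInv]
    exact (antipode_sq_eq_sandwich_iff χ a).2 hP.intertwine
  · show P.IsGivenBy (charInv (charInv χ)) a.val
    rw [charInv_charInv]
    exact hP

end HopfRep

end

theorem proposition3p4 (k H : Type u) [Field k] [Ring H] [HopfAlgebra k H] [Module.Finite k H] :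
    ∃ e : HopfRep.KRPair k H ≃ HopfRep.ShimizuSqrt k H,
      ∀ (p : HopfRep.KRPair k H) (P : HopfRep.ShimizuSqrtObj k H),
        e p = Quotient.mk _ P →
          (∀ (h : H) (v : P.1.V), P.1.V.ρ h v = HopfRep.charInv p.ζ h • v) ∧
          ∀ (X : HopfRep.FDMod k H) (v : P.1.V) (x : X),
            P.1.σ X (v ⊗ₜ[k] x) = Module.Dual.eval k X (X.ρ p.a.val x) ⊗ₜ[k] v := by
  have hclass : ∀ (p : HopfRep.KRPair k H) (P : HopfRep.ShimizuSqrtObj k H),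
      (Quotient.mk _ p.toSqrtObj : HopfRep.ShimizuSqrt k H) = Quotient.mk _ P →
        P.1.IsGivenBy (HopfRep.charInv p.ζ) p.a.val := fun p P h =>
    p.toSqrtObj_isGivenBy.of_equivalent (Quotient.exact h)
  refine ⟨Equiv.ofBijective (fun p => Quotient.mk _ p.toSqrtObj) ⟨fun p q h => ?_, fun Q => ?_⟩,
    fun p P h => ⟨(hclass p P h).actsBy, (hclass p P h).σ_tmul⟩⟩
  · have : Nontrivial q.toSqrtObj.1.V := inferInstanceAs (Nontrivial k)
    obtain ⟨hζ, ha⟩ := (hclass p _ h).unique q.toSqrtObj_isGivenBy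
    have hζ' : p.ζ = q.ζ := by rw [← HopfRep.charInv_charInv p.ζ, hζ, HopfRep.charInv_charInv]
    cases p
    cases q
    congr
    exact GroupLike.val_injective ha
  · obtain ⟨P, rfl⟩ := Quotient.exists_rep Q
    obtain ⟨p, hp⟩ := HopfRep.ShimizuSqrtObj.exists_isGivenBy P
    refine ⟨p, Quotient.sound (p.toSqrtObj_isGivenBy.equivalent hp ?_)⟩
    rw [(HopfRep.FDMod.invertible_iff _).1 P.2.1]
    exact Module.finrank_self k
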